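/- Let $p$ be a prime, $n\ge 0$, and let $g\in\mathbb{Z}_p[x_1^{\pm1},\dots,x_n^{\pm1}]$ be a Laurent polynomial. Let $\Delta\subset\mathbb{R}^n$ be its Newton polytope, i.e. the convex hull of the exponent vectors of the monomials occurring in $g$ with non-zero coefficient, and suppose that $\mathbf 0$ lies in the interior of $\Delta$ and is the only point of $\mathbb{Z}^n$ there. (Here the interior of $\Delta$ is taken relative to its affine hull; when $\Delta$ has dimension $n$ this is the usual interior.) For $k\ge0$ let $b_k\in\mathbb{Z}_p$ be the constant term of $g^k$, and put $$q(t)=\sum_{k\ge 0} b_k t^k\in\mathbb{Z}_p[[t]],\qquad \gamma_m(t)=\sum_{k=0}^{m-1} b_k t^k\quad(m\ge 1).$$ All these series have constant term $1$, so they are invertible in $\mathbb{Z}_p[[t]]$, and the following congruences hold between elements of $\mathbb{Z}_p[[t]]$: 1. for every $s\ge 1$, $$\frac{q(t)}{q(t^p)}\equiv\frac{\gamma_{p^s}(t)}{\gamma_{p^{s-1}}(t^p)}\pmod{p^s\,\mathbb{Z}_p[[t]]};$$ 2. more generally, for every $m\ge1$ divisible by $p$, $$\frac{q(t)}{q(t^p)}\equiv\frac{\gamma_{m}(t)}{\gamma_{m/p}(t^p)}\pmod{p^{\mathrm{ord}_p(m)}\,\mathbb{Z}_p[[t]]};$$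 3. for every $m\ge1$, $$\frac{q'(t)}{q(t)}\equiv\frac{\gamma_m'(t)}{\gamma_m(t)}\pmod{p^{\mathrm{ord}_p(m)}\,\mathbb{Z}_p[[t]]}.$$ -/

import Mathlib

open PowerSeries

namespace DworkCongruence

noncomputable section

/-- Laurent polynomials in `n` variables over `R`: finitely supported functions on the
lattice `ℤⁿ` of exponents, with convolution as multiplication. -/
abbrev LaurentPoly (R : Type*) [CommRing R] (n : ℕ) : Type _ :=
  AddMonoidAlgebra R (Fin n → ℤ)

/-- The lattice point `v ∈ ℤⁿ` as a point of `ℝⁿ`. -/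
def latticePoint {n : ℕ} (v : Fin n → ℤ) : Fin n → ℝ := fun i => (v i : ℝ)

/-- The Newton polytope of `g`: the convex hull in `ℝⁿ` of the exponents of the monomials
that occur in `g` with a non-zero coefficient. -/
def newtonPolytope {R : Type*} [CommRing R] {n : ℕ} (g : LaurentPoly R n) :
    Set (Fin n → ℝ) :=
  convexHull ℝ (latticePoint '' (g.coeff.support : Set (Fin n → ℤ)))

/-- `0` is the one and only lattice point in the (relative) interior of the Newton polytope.
For a polytope of full dimension `intrinsicInterior ℝ` is the topological interior in `ℝⁿ`. -/
def ZeroIsOnlyInteriorLatticePoint {R : Type*} [CommRing R] {n : ℕ}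
    (g : LaurentPoly R n) : Prop :=
  ∀ v : Fin n → ℤ, latticePoint v ∈ intrinsicInterior ℝ (newtonPolytope g) ↔ v = 0

/-- `b k`, the constant term of `g ^ k`. -/
def b {R : Type*} [CommRing R] {n : ℕ} (g : LaurentPoly R n) (k : ℕ) : R :=
  (g ^ k).coeff 0

/-- The series `q(t) = ∑ b_k t^k`. -/
def q {R : Type*} [CommRing R] {n : ℕ} (g : LaurentPoly R n) : R⟦X⟧ :=
  PowerSeries.mk (b g)

/-- The truncation `γ_m(t) = ∑_{k < m} b_k t^k` of `q`, a polynomial seen as a power series. -/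
def γ {R : Type*} [CommRing R] {n : ℕ} (g : LaurentPoly R n) (m : ℕ) : R⟦X⟧ :=
  ((PowerSeries.trunc m (q g) : Polynomial R) : R⟦X⟧)

/-- The substitution `h(t) ↦ h(t^p)`. -/
def atPow (p : ℕ) [Fact p.Prime] {R : Type*} [CommRing R] (h : R⟦X⟧) : R⟦X⟧ :=
  PowerSeries.expand p (Fact.out : p.Prime).ne_zero h

/-- `a₁ / c₁ ≡ a₂ / c₂ mod p^e` in `ℤ_p⟦t⟧`: both denominators are invertible power series,
and the difference of the two quotients lies in `p^e ℤ_p⟦t⟧`. -/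
def QuotCongr (p : ℕ) [Fact p.Prime] (e : ℕ) (a₁ c₁ a₂ c₂ : ℤ_[p]⟦X⟧) : Prop :=
  IsUnit c₁ ∧ IsUnit c₂ ∧
    (p : ℤ_[p]⟦X⟧) ^ e ∣ a₁ * Ring.inverse c₁ - a₂ * Ring.inverse c₂

end

end DworkCongruence

/-! Let `φ` be the Frobenius lift `x ↦ x^p`. Recursively, `g^N` expands as the sum over `l < s` of
`Q_l(N mod p^(l+1)) φ^(l+1)(g^⌊N/p^(l+1)⌋)`, plus `Q_s(N)`. Two facts matter: `p^s` divides `Q_s(N)`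
(`dvd_frobRemainder`), and `Q_s(N)` is supported in `N Δ`. If `r < P`, a lattice point `P v` of `r
Δ` has `v` in the interior of `Δ`, so `v = 0`. Constant terms are therefore multiplicative on the
products above (`b_eq_sum_ghostTerm`), and modulo `p^s` the series `q` is the sum over `l < s` of
`D_l(t) q(t^(p^(l+1)))`, where `D_l` has degree below `p^(l+1)` and is divisible by `p^l`.
Truncation respects base-`p` digits: `N < m p^s` iff `⌊N/p^(l+1)⌋ < m p^(s-1-l)`. Hence `γ_(m p^s)`
obeys the same recursion as `q`, and `u_s = γ_(m p^s) / q` satisfies `u_(s+1)(t) ≡ u_s(t^p)` modulo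
`p^(s+1)` (`dvd_quotient_sub_map`). This is congruence 2, with 1 a special case. Differentiating `t
↦ t^p` gains a factor `p`, so `p^s` divides `u_s'`, which gives 3. -/

namespace DworkCongruence

open Finset
open scoped Pointwise

noncomputable section

/-! ### Expansion of powers along a Frobenius lift -/

section FrobeniusLift

variable {A : Type*} [CommRing A]

/-- The remainders `Q s N` in the expansion of `g ^ N` along a Frobenius lift `φ`:
`g ^ N = ∑ l < s, Q l (N % p ^ (l + 1)) * φ ^ (l + 1) (g ^ (N / p ^ (l + 1))) + Q s N`. -/
def frobRemainder (p : ℕ) (φ : A →+* A) (g : A) (s N : ℕ) : A :=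
  g ^ N - ∑ l : Fin s, frobRemainder p φ g l (N % p ^ (l.1 + 1)) *
    (φ ^ (l.1 + 1)) (g ^ (N / p ^ (l.1 + 1)))
termination_by s
decreasing_by exact l.2

theorem pow_eq_sum_frobRemainder (p : ℕ) (φ : A →+* A) (g : A) (s N : ℕ) :
    g ^ N = ∑ l ∈ range s, frobRemainder p φ g l (N % p ^ (l + 1)) *
      (φ ^ (l + 1)) (g ^ (N / p ^ (l + 1))) + frobRemainder p φ g s N := by
  rw [frobRemainder, Finset.sum_range]
  ring

theorem dvd_frobPow_sub_pow {p : ℕ} {φ : A →+* A} (hφ : ∀ a, (p : A) ∣ φ a - a ^ p)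
    (l : ℕ) (a : A) : (p : A) ∣ (φ ^ l) a - a ^ p ^ l := by
  induction l with
  | zero => simp
  | succ l ih =>
    have h1 : (p : A) ∣ φ ((φ ^ l) a) - φ (a ^ p ^ l) := by
      simpa using map_dvd φ ih
    have h2 := hφ (a ^ p ^ l)
    have h3 := dvd_add h1 h2
    rw [pow_succ' φ, pow_succ p, pow_mul]
    simpa using h3

/-- Splitting off the digits of `N` above `p^s` turns the remainder into a sum of earlier remainders
times differences `g^(p^(s+1) d) - φ^(l+1)(g^(p^(s-l) d))`; the earlier remainder gives `p^l`, the
difference `p^(s+1-l)`. -/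
theorem dvd_frobRemainder {p : ℕ} (hp : 0 < p) {φ : A →+* A}
    (hφ : ∀ a, (p : A) ∣ φ a - a ^ p) (g : A) (s N : ℕ) :
    (p : A) ^ s ∣ frobRemainder p φ g s N := by
  induction s using Nat.strong_induction_on generalizing N with
  | _ s ih =>
  rcases s with _ | s
  · simp
  set d := N / p ^ (s + 1) with hd
  set r := N % p ^ (s + 1) with hr
  have hN : N = r + p ^ (s + 1) * d := (Nat.mod_add_div _ _).symm
  have hmod : ∀ l < s + 1, r % p ^ (l + 1) = N % p ^ (l + 1) := fun l hl =>
    Nat.mod_mod_of_dvd _ (pow_dvd_pow p (by omega))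
  have hdiv : ∀ l < s + 1, N / p ^ (l + 1) = r / p ^ (l + 1) + p ^ (s - l) * d := by
    intro l hl
    have h : p ^ (s + 1) * d = p ^ (l + 1) * (p ^ (s - l) * d) := by
      rw [← mul_assoc, ← pow_add]; congr 2; omega
    rw [hN, h, Nat.add_mul_div_left _ _ (by positivity)]
  have hgr : g ^ r = ∑ l ∈ range (s + 1), frobRemainder p φ g l (N % p ^ (l + 1)) *
      (φ ^ (l + 1)) (g ^ (r / p ^ (l + 1))) := by
    rw [pow_eq_sum_frobRemainder p φ g s r, Finset.sum_range_succ]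
    -- Since `r < p^(s+1)`, the final remainder of level `s` has the shape of the summand `l = s`.
    have hlt : r / p ^ (s + 1) = 0 := Nat.div_eq_of_lt (Nat.mod_lt _ (by positivity))
    rw [hlt, pow_zero, map_one, mul_one]
    congr 1
    refine Finset.sum_congr rfl fun l hl => ?_
    rw [hmod l (by have := Finset.mem_range.1 hl; omega)]
  have key : frobRemainder p φ g (s + 1) N = ∑ l ∈ range (s + 1),
      frobRemainder p φ g l (N % p ^ (l + 1)) * (φ ^ (l + 1)) (g ^ (r / p ^ (l + 1))) *
        (g ^ (p ^ (s + 1) * d) - (φ ^ (l + 1)) (g ^ (p ^ (s - l) * d))) := by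
    rw [← add_right_inj (∑ l ∈ range (s + 1), frobRemainder p φ g l (N % p ^ (l + 1)) *
      (φ ^ (l + 1)) (g ^ (N / p ^ (l + 1)))), ← pow_eq_sum_frobRemainder,
      ← Finset.sum_add_distrib]
    conv_lhs => rw [hN, pow_add, hgr, Finset.sum_mul]
    refine Finset.sum_congr rfl fun l hl => ?_
    rw [hdiv l (Finset.mem_range.1 hl), pow_add g, map_mul]
    ring
  rw [key]
  refine Finset.dvd_sum fun l hl => ?_
  have hl : l < s + 1 := Finset.mem_range.1 hl
  have h1 : (p : A) ^ (s - l + 1) ∣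
      g ^ (p ^ (s + 1) * d) - (φ ^ (l + 1)) (g ^ (p ^ (s - l) * d)) := by
    -- A congruence modulo `p` becomes one modulo `p^(k+1)` after raising both sides to the power
    -- `p^k`.
    have h := dvd_sub_pow_of_dvd_sub (dvd_frobPow_sub_pow hφ (l + 1) (g ^ d)) (s - l)
    rw [← dvd_neg, neg_sub]
    convert h using 2
    · rw [← map_pow, ← pow_mul, mul_comm]
    · rw [← pow_mul, ← pow_mul, mul_comm, ← pow_add]
      congr 2; rw [show l + 1 + (s - l) = s + 1 by omega]
  have h2 := mul_dvd_mul ((ih l hl (N % p ^ (l + 1))).mul_right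
    ((φ ^ (l + 1)) (g ^ (r / p ^ (l + 1))))) h1
  rw [← pow_add] at h2
  convert h2 using 2
  omega

end FrobeniusLift

/-! ### Quotients of two solutions of one recursion -/

section Quotients

variable {B : Type*} [CommRing B]

/-- Multiply the recursion for `G` by `σ (u s)` and compare with that for `F`: the summands differ
by `D l` times `σ (u s - σ^l (u (s - l)))`, and the `p^l` in `D l` makes up for the precision lost
in the second factor. -/
theorem dvd_quotient_sub_map {p : ℕ} {σ : B →+* B} {D F G u : ℕ → B}
    (hD : ∀ l, (p : B) ^ l ∣ D l) (hu : ∀ k, F k = u k * G k) (hG : ∀ k, IsUnit (G k))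
    (hF : ∀ s, (p : B) ^ s ∣ F s - ∑ l ∈ range s, D l * (σ ^ (l + 1)) (F (s - 1 - l)))
    (hG' : ∀ s, (p : B) ^ s ∣ G s - ∑ l ∈ range s, D l * (σ ^ (l + 1)) (G (s - 1 - l)))
    (s : ℕ) : (p : B) ^ (s + 1) ∣ u (s + 1) - σ (u s) := by
  induction s using Nat.strong_induction_on with
  | _ s ih =>
  -- Telescoping the induction hypothesis; each step down costs one power of `p`.
  have chain : ∀ l ≤ s, (p : B) ^ (s + 1 - l) ∣ u s - (σ ^ l) (u (s - l)) := by
    intro l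
    induction l with
    | zero => simp
    | succ l ihl =>
      intro hl
      have h1 := (pow_dvd_pow (p : B) (show s + 1 - (l + 1) ≤ s + 1 - l by omega)).trans
        (ihl (by omega))
      have h2 := map_dvd (σ ^ l) (ih (s - (l + 1)) (by omega))
      rw [map_pow, map_natCast, map_sub, show s - (l + 1) + 1 = s - l by omega] at h2
      have h3 := dvd_add h1 ((pow_dvd_pow (p : B) (show s + 1 - (l + 1) ≤ s - l by omega)).trans h2)
      rw [pow_succ σ]
      simpa using h3
  rw [← (hG (s + 1)).dvd_mul_right]
  have e : (u (s + 1) - σ (u s)) * G (s + 1) =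
      (F (s + 1) - ∑ l ∈ range (s + 1), D l * (σ ^ (l + 1)) (F (s + 1 - 1 - l)))
      - σ (u s) * (G (s + 1) - ∑ l ∈ range (s + 1), D l * (σ ^ (l + 1)) (G (s + 1 - 1 - l)))
      - ∑ l ∈ range (s + 1), D l * σ (u s - (σ ^ l) (u (s - l))) * (σ ^ (l + 1)) (G (s - l)) := by
    have e2 : ∑ l ∈ range (s + 1), D l * σ (u s - (σ ^ l) (u (s - l))) * (σ ^ (l + 1)) (G (s - l))
        = σ (u s) * ∑ l ∈ range (s + 1), D l * (σ ^ (l + 1)) (G (s + 1 - 1 - l))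
          - ∑ l ∈ range (s + 1), D l * (σ ^ (l + 1)) (F (s + 1 - 1 - l)) := by
      rw [Finset.mul_sum, ← Finset.sum_sub_distrib]
      refine Finset.sum_congr rfl fun l _ => ?_
      rw [Nat.add_sub_cancel, hu (s - l), map_mul, map_sub, pow_succ' σ]
      simp only [RingHom.mul_def, RingHom.comp_apply]
      ring
    rw [e2, hu (s + 1)]
    ring
  rw [e]
  refine dvd_sub (dvd_sub (hF _) ((hG' _).mul_left _)) (Finset.dvd_sum fun l hl => ?_)
  have hl : l ≤ s := by have := Finset.mem_range.1 hl; omega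
  have h1 := map_dvd σ (chain l hl)
  rw [map_pow, map_natCast] at h1
  have h2 := (mul_dvd_mul (hD l) h1).mul_right ((σ ^ (l + 1)) (G (s - l)))
  rw [← pow_add] at h2
  convert h2 using 2
  omega

theorem dvd_mul_inverse_sub_mul_inverse {x a₁ c₁ a₂ c₂ : B} (h₁ : IsUnit c₁) (h₂ : IsUnit c₂)
    (h : x ∣ a₁ * c₂ - a₂ * c₁) :
    x ∣ a₁ * Ring.inverse c₁ - a₂ * Ring.inverse c₂ := by
  have e : a₁ * Ring.inverse c₁ - a₂ * Ring.inverse c₂ =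
      (a₁ * c₂ - a₂ * c₁) * (Ring.inverse c₁ * Ring.inverse c₂) := by
    linear_combination (-a₁ * Ring.inverse c₁) * Ring.mul_inverse_cancel _ h₂ +
      (a₂ * Ring.inverse c₂) * Ring.mul_inverse_cancel _ h₁
  rw [e]
  exact h.mul_right _

end Quotients

/-! ### Power series: divisibility, `t ↦ t^P`, derivatives -/

section PowerSeriesLemmas

variable {R : Type*} [CommRing R]

theorem natCast_pow_dvd_of_coeff {p e : ℕ} {f : R⟦X⟧}
    (h : ∀ N, (p : R) ^ e ∣ coeff N f) : (p : R⟦X⟧) ^ e ∣ f := by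
  choose c hc using h
  refine ⟨PowerSeries.mk c, ?_⟩
  ext N
  have : (p : R⟦X⟧) ^ e = C ((p : R) ^ e) := by simp
  rw [this, coeff_C_mul, coeff_mk, hc]

theorem expand_pow_apply {p : ℕ} (hp : p ≠ 0) (l : ℕ) (f : R⟦X⟧) :
    (((PowerSeries.expand p hp : R⟦X⟧ →ₐ[R] R⟦X⟧) : R⟦X⟧ →+* R⟦X⟧) ^ l) f =
      PowerSeries.expand (p ^ l) (pow_ne_zero l hp) f := by
  induction l generalizing f with
  | zero => simp
  | succ l ih =>
    simp only [pow_succ p]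
    rw [pow_succ, RingHom.mul_def, RingHom.comp_apply, ih,
      PowerSeries.expand_mul (p ^ l) (pow_ne_zero l hp) p hp]
    rfl

/-- Division with remainder: `N = i + P j` with `i < P` has exactly one solution. -/
theorem coeff_mk_mul_expand {P : ℕ} (hP : P ≠ 0) (d : ℕ → R) (f : R⟦X⟧) (N : ℕ) :
    coeff N (PowerSeries.mk (fun r => if r < P then d r else 0) * PowerSeries.expand P hP f) =
      d (N % P) * coeff (N / P) f := by
  rw [coeff_mul, Finset.sum_eq_single (N % P, P * (N / P))]
  · rw [coeff_mk, if_pos (Nat.mod_lt _ (Nat.pos_of_ne_zero hP)), coeff_expand_mul]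
  · rintro ⟨i, j⟩ hij hne
    rw [Finset.HasAntidiagonal.mem_antidiagonal] at hij
    dsimp only at hij ⊢
    rw [coeff_mk]
    split_ifs with hi
    · by_cases hj : P ∣ j
      · obtain ⟨j, rfl⟩ := hj
        exfalso
        apply hne
        rw [← hij, Nat.add_mul_mod_self_left, Nat.mod_eq_of_lt hi,
          Nat.add_mul_div_left _ _ (Nat.pos_of_ne_zero hP), Nat.div_eq_of_lt hi, zero_add]
      · rw [coeff_expand_of_not_dvd _ _ _ hj, mul_zero]
    · rw [zero_mul]
  · intro h
    exact absurd (Finset.HasAntidiagonal.mem_antidiagonal.2 (Nat.mod_add_div _ _)) h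

theorem derivative_expand {p : ℕ} (hp : p ≠ 0) (f : R⟦X⟧) :
    PowerSeries.derivative R (PowerSeries.expand p hp f) =
      (p : R⟦X⟧) * PowerSeries.X ^ (p - 1) * PowerSeries.expand p hp (PowerSeries.derivative R f) := by
  rw [expand_apply, expand_apply, derivative_subst (HasSubst.X_pow hp), derivative_pow]
  simp
  ring

theorem dvd_derivative {p e : ℕ} {f : R⟦X⟧} (h : (p : R⟦X⟧) ^ e ∣ f) :
    (p : R⟦X⟧) ^ e ∣ PowerSeries.derivative R f := by
  obtain ⟨w, rfl⟩ := h
  have : (p : R⟦X⟧) ^ e = C ((p : R) ^ e) := by simp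
  rw [this, ← smul_eq_C_mul, Derivation.map_smul, smul_eq_C_mul]
  exact dvd_mul_right _ _

end PowerSeriesLemmas

/-! ### Frobenius and supports of Laurent polynomials -/

section LaurentPolynomials

variable {R : Type*} [CommRing R] {n : ℕ}

/-- The substitution `x ↦ x ^ p` on Laurent polynomials. -/
def laurentFrob (R : Type*) [CommRing R] (n p : ℕ) : LaurentPoly R n →+* LaurentPoly R n :=
  AddMonoidAlgebra.mapDomainRingHom R (p • AddMonoidHom.id (Fin n → ℤ))

theorem laurentFrob_single (p : ℕ) (v : Fin n → ℤ) (a : R) :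
    laurentFrob R n p (AddMonoidAlgebra.single v a) = AddMonoidAlgebra.single (p • v) a := by
  simp [laurentFrob]

theorem dvd_laurentFrob_sub_pow {p : ℕ} (hp : p.Prime) (hR : ∀ a : R, (p : R) ∣ a - a ^ p)
    (h : LaurentPoly R n) : (p : LaurentPoly R n) ∣ laurentFrob R n p h - h ^ p := by
  induction h using AddMonoidAlgebra.induction_linear with
  | zero => simp [hp.ne_zero]
  | add x y hx hy =>
    obtain ⟨r, hr⟩ := exists_add_pow_prime_eq hp x y
    have : laurentFrob R n p (x + y) - (x + y) ^ p = (laurentFrob R n p x - x ^ p) +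
        (laurentFrob R n p y - y ^ p) - p * (x * y * r) := by
      rw [hr, map_add]; ring
    rw [this]
    exact dvd_sub (dvd_add hx hy) (dvd_mul_right _ _)
  | single v a =>
    obtain ⟨c, hc⟩ := hR a
    refine ⟨AddMonoidAlgebra.single (p • v) c, ?_⟩
    rw [laurentFrob_single, AddMonoidAlgebra.single_pow, ← AddMonoidAlgebra.single_sub, hc,
      AddMonoidAlgebra.natCast_def, AddMonoidAlgebra.single_mul_single, zero_add]

theorem laurentFrob_pow (p l : ℕ) : laurentFrob R n p ^ l = laurentFrob R n (p ^ l) := by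
  have hs : ∀ v a, (laurentFrob R n p ^ l) (AddMonoidAlgebra.single v a) =
      AddMonoidAlgebra.single (p ^ l • v) a := by
    induction l with
    | zero => simp
    | succ l ih =>
      intro v a
      rw [pow_succ', RingHom.mul_def, RingHom.comp_apply, ih, laurentFrob_single, smul_smul,
        pow_succ']
  refine AddMonoidAlgebra.ringHom_ext (fun a => ?_) (fun v => ?_) <;>
    rw [hs, laurentFrob_single]

/-- An exponent `P • v` of the second factor must meet `-P • v` in `f`, which only `v = 0` allows.
-/
theorem coeff_zero_mul_laurentFrob {P : ℕ} {f : LaurentPoly R n}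
    (hf : ∀ v, f.coeff (P • v) ≠ 0 → v = 0) (h : LaurentPoly R n) :
    (f * laurentFrob R n P h).coeff 0 = f.coeff 0 * h.coeff 0 := by
  induction h using AddMonoidAlgebra.induction_linear with
  | zero => simp
  | add x y hx hy =>
    rw [map_add, mul_add, AddMonoidAlgebra.coeff_add, Finsupp.add_apply, hx, hy,
      AddMonoidAlgebra.coeff_add, Finsupp.add_apply, mul_add]
  | single v a =>
    rw [laurentFrob_single, AddMonoidAlgebra.coeff_mul_single_apply]
    by_cases hv : v = 0
    · simp [hv]
    · have h0 : f.coeff (P • -v) = 0 := by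
        by_contra hne
        exact hv (neg_eq_zero.1 (hf _ hne))
      rw [AddMonoidAlgebra.coeff_single, Finsupp.single_eq_of_ne (Ne.symm hv)]
      rw [smul_neg] at h0
      rw [zero_add, h0, zero_mul, mul_zero]

/-- The Laurent polynomials whose exponents lie in `N • Δ`. -/
def SupportedIn (Δ : Set (Fin n → ℝ)) (N : ℕ) (h : LaurentPoly R n) : Prop :=
  ∀ v, h.coeff v ≠ 0 → latticePoint v ∈ (N : ℝ) • Δ

variable {Δ : Set (Fin n → ℝ)}

theorem latticePoint_add (u v : Fin n → ℤ) :
    latticePoint (u + v) = latticePoint u + latticePoint v := by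
  ext i; simp [latticePoint]

theorem latticePoint_nsmul (P : ℕ) (v : Fin n → ℤ) :
    latticePoint (P • v) = (P : ℝ) • latticePoint v := by
  ext i; simp [latticePoint]

theorem SupportedIn.sub {N : ℕ} {h₁ h₂ : LaurentPoly R n} (H₁ : SupportedIn Δ N h₁)
    (H₂ : SupportedIn Δ N h₂) : SupportedIn Δ N (h₁ - h₂) := by
  intro v hv
  by_cases h : h₁.coeff v = 0
  · refine H₂ v fun h' => hv ?_
    simp [h, h']
  · exact H₁ v h

theorem SupportedIn.sum {ι : Type*} {s : Finset ι} {N : ℕ} {h : ι → LaurentPoly R n}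
    (H : ∀ i ∈ s, SupportedIn Δ N (h i)) : SupportedIn Δ N (∑ i ∈ s, h i) := by
  intro v hv
  rw [AddMonoidAlgebra.coeff_sum, Finsupp.finsetSum_apply] at hv
  obtain ⟨i, hi, hne⟩ := Finset.exists_ne_zero_of_sum_ne_zero hv
  exact H i hi v hne

theorem SupportedIn.mul (hΔ : Convex ℝ Δ) {N M : ℕ} {h₁ h₂ : LaurentPoly R n}
    (H₁ : SupportedIn Δ N h₁) (H₂ : SupportedIn Δ M h₂) : SupportedIn Δ (N + M) (h₁ * h₂) := by
  classical
  intro v hv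
  have := AddMonoidAlgebra.support_coeff_mul_subset h₁ h₂ (Finsupp.mem_support_iff.2 hv)
  obtain ⟨u, hu, w, hw, rfl⟩ := Finset.mem_add.1 this
  rw [latticePoint_add, Nat.cast_add, hΔ.add_smul (Nat.cast_nonneg _) (Nat.cast_nonneg _)]
  exact Set.add_mem_add (H₁ u (Finsupp.mem_support_iff.1 hu)) (H₂ w (Finsupp.mem_support_iff.1 hw))

theorem SupportedIn.one (h0 : Δ.Nonempty) : SupportedIn Δ 0 (1 : LaurentPoly R n) := by
  intro v hv
  rw [AddMonoidAlgebra.one_def, AddMonoidAlgebra.coeff_single] at hv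
  have hv0 : v = 0 := by
    by_contra h
    exact hv (Finsupp.single_eq_of_ne h)
  rw [Nat.cast_zero, Set.zero_smul_set h0, hv0, Set.mem_zero]
  ext i; simp [latticePoint]

theorem SupportedIn.pow (hΔ : Convex ℝ Δ) (h0 : Δ.Nonempty) {h : LaurentPoly R n}
    (H : SupportedIn Δ 1 h) (N : ℕ) : SupportedIn Δ N (h ^ N) := by
  induction N with
  | zero => simpa using SupportedIn.one h0
  | succ N ih => rw [pow_succ]; exact ih.mul hΔ H

theorem SupportedIn.laurentFrob {P N : ℕ} {h : LaurentPoly R n} (H : SupportedIn Δ N h) :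
    SupportedIn Δ (P * N) (laurentFrob R n P h) := by
  classical
  intro v hv
  have := Finsupp.mapDomain_support (Finsupp.mem_support_iff.2 hv)
  obtain ⟨u, hu, rfl⟩ := Finset.mem_image.1 this
  change latticePoint (P • u) ∈ _
  rw [latticePoint_nsmul, Nat.cast_mul, mul_smul]
  exact Set.smul_mem_smul_set (H u (Finsupp.mem_support_iff.1 hu))

theorem SupportedIn.frobRemainder (hΔ : Convex ℝ Δ) (h0 : Δ.Nonempty) (p : ℕ)
    {g : LaurentPoly R n} (H : SupportedIn Δ 1 g) (s N : ℕ) :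
    SupportedIn Δ N (frobRemainder p (DworkCongruence.laurentFrob R n p) g s N) := by
  induction s using Nat.strong_induction_on generalizing N with
  | _ s ih =>
  rw [DworkCongruence.frobRemainder]
  refine (H.pow hΔ h0 N).sub (SupportedIn.sum fun l _ => ?_)
  have h := (ih l l.2 (N % p ^ (l.1 + 1))).mul hΔ
    ((H.pow hΔ h0 (N / p ^ (l.1 + 1))).laurentFrob (P := p ^ (l.1 + 1)))
  rw [Nat.mod_add_div] at h
  rwa [laurentFrob_pow]

end LaurentPolynomials

/-! ### Shrinking a convex set towards an interior point -/

section ConvexGeometry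

theorem smul_mem_intrinsicInterior {E : Type*} [NormedAddCommGroup E] [NormedSpace ℝ E]
    {s : Set E} (hs : Convex ℝ s) (h0 : (0 : E) ∈ intrinsicInterior ℝ s) {x : E} (hx : x ∈ s)
    {c : ℝ} (hc : 0 ≤ c) (hc1 : c < 1) : c • x ∈ intrinsicInterior ℝ s := by
  have h0s := intrinsicInterior_subset h0
  obtain ⟨z, hz, hz0⟩ := h0
  have hcx : c • x ∈ s := hs.smul_mem_of_zero_mem h0s hx ⟨hc, hc1.le⟩
  let x' : affineSpan ℝ s := ⟨x, subset_affineSpan ℝ s hx⟩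
  -- Inverse of the homothety with centre `x` and ratio `1 - c`. It sends `c • x` to `0`, and `y = c
  -- • x + (1 - c) • ψ y`, so the preimage of the interior is a neighbourhood of `c • x` inside `s`.
  let ψ : affineSpan ℝ s → affineSpan ℝ s := fun y =>
    ⟨AffineMap.lineMap x (y : E) (1 - c)⁻¹, AffineMap.lineMap_mem _ x'.2 y.2⟩
  have hψ : Continuous ψ := by
    refine Continuous.subtype_mk ?_ _
    simp only [AffineMap.lineMap_apply_module]
    fun_prop
  have hne : 1 - c ≠ 0 := by linarith
  refine ⟨⟨c • x, subset_affineSpan ℝ s hcx⟩, ?_, rfl⟩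
  rw [mem_interior]
  refine ⟨ψ ⁻¹' interior ((↑) ⁻¹' s), ?_, isOpen_interior.preimage hψ, ?_⟩
  · intro y hy
    have hy' : AffineMap.lineMap x (y : E) (1 - c)⁻¹ ∈ s :=
      (interior_subset hy : ψ y ∈ _)
    have := hs hx hy' hc (by linarith : 0 ≤ 1 - c) (by ring)
    rw [AffineMap.lineMap_apply_module, smul_add, smul_smul, smul_smul, mul_inv_cancel₀ hne,
      one_smul, ← add_assoc, ← add_smul,
      show c + (1 - c) * (1 - (1 - c)⁻¹) = 0 by field_simp; ring, zero_smul, zero_add] at this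
    exact this
  · change ψ _ ∈ interior _
    convert hz
    apply Subtype.ext
    change AffineMap.lineMap x (c • x) (1 - c)⁻¹ = (z : E)
    rw [hz0, AffineMap.lineMap_apply_module, smul_smul, ← add_smul,
      show 1 - (1 - c)⁻¹ + (1 - c)⁻¹ * c = 0 by field_simp; ring, zero_smul]

end ConvexGeometry

/-! ### Recursion for the constant terms -/

section ConstantTerms

variable {R : Type*} [CommRing R] {n : ℕ} {g : LaurentPoly R n}

theorem ZeroIsOnlyInteriorLatticePoint.eq_zero_of_nsmul_mem
    (hg : ZeroIsOnlyInteriorLatticePoint g) {P r : ℕ} (hr : r < P) {v : Fin n → ℤ}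
    (hv : latticePoint (P • v) ∈ (r : ℝ) • newtonPolytope g) : v = 0 := by
  rw [← hg v]
  have h0 : (0 : Fin n → ℝ) ∈ intrinsicInterior ℝ (newtonPolytope g) := by
    have : latticePoint (0 : Fin n → ℤ) = 0 := by ext i; simp [latticePoint]
    rw [← this]; exact (hg 0).2 rfl
  obtain ⟨x, hx, hxv⟩ := hv
  have hP : (0 : ℝ) < P := by exact_mod_cast (Nat.zero_le r).trans_lt hr
  -- The ratio `r / P` is below `1`, so `v` is strictly shrunk towards `0`.
  have e : latticePoint v = ((r : ℝ) / P) • x := by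
    rw [latticePoint_nsmul] at hxv
    have hxv : (r : ℝ) • x = (P : ℝ) • latticePoint v := hxv
    rw [div_eq_inv_mul, mul_smul, hxv, smul_smul, inv_mul_cancel₀ hP.ne', one_smul]
  rw [e]
  exact smul_mem_intrinsicInterior (convex_convexHull ℝ _) h0 hx (by positivity)
    ((div_lt_one hP).2 (by exact_mod_cast hr))

theorem supportedIn_newtonPolytope (g : LaurentPoly R n) : SupportedIn (newtonPolytope g) 1 g := by
  intro v hv
  rw [Nat.cast_one, one_smul]
  exact subset_convexHull ℝ _ ⟨v, Finsupp.mem_support_iff.2 hv, rfl⟩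

/-- The constant terms of the remainders `frobRemainder`. -/
def ghostTerm (p : ℕ) (g : LaurentPoly R n) (s N : ℕ) : R :=
  (frobRemainder p (laurentFrob R n p) g s N).coeff 0

theorem b_eq_sum_ghostTerm (hg : ZeroIsOnlyInteriorLatticePoint g) {p : ℕ} (hp : 0 < p)
    (s N : ℕ) : b g N = ∑ l ∈ range s, ghostTerm p g l (N % p ^ (l + 1)) *
      b g (N / p ^ (l + 1)) + ghostTerm p g s N := by
  have hne : (newtonPolytope g).Nonempty := ⟨_, intrinsicInterior_subset ((hg 0).2 rfl)⟩
  rw [b, pow_eq_sum_frobRemainder p (laurentFrob R n p) g s N, AddMonoidAlgebra.coeff_add,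
    Finsupp.add_apply, AddMonoidAlgebra.coeff_sum, Finsupp.finsetSum_apply]
  congr 1
  refine Finset.sum_congr rfl fun l _ => ?_
  rw [laurentFrob_pow, coeff_zero_mul_laurentFrob]
  · rfl
  · intro v hv
    exact hg.eq_zero_of_nsmul_mem (Nat.mod_lt N (pow_pos hp (l + 1)))
      ((supportedIn_newtonPolytope g).frobRemainder (convex_convexHull ℝ _) hne p _ _ _ hv)

theorem dvd_ghostTerm {p : ℕ} (hp : p.Prime) (hR : ∀ a : R, (p : R) ∣ a - a ^ p)
    (g : LaurentPoly R n) (s N : ℕ) : (p : R) ^ s ∣ ghostTerm p g s N := by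
  obtain ⟨w, hw⟩ := dvd_frobRemainder hp.pos (dvd_laurentFrob_sub_pow hp hR) g s N
  have e : (p : LaurentPoly R n) ^ s = AddMonoidAlgebra.single 0 ((p : R) ^ s) := by
    rw [AddMonoidAlgebra.natCast_def, AddMonoidAlgebra.single_pow, smul_zero]
  rw [ghostTerm, hw, e, AddMonoidAlgebra.coeff_single_zero_mul]
  exact dvd_mul_right _ _

end ConstantTerms

/-! ### Congruences for `q` and its truncations -/

section Congruences

variable {p : ℕ} [hp : Fact p.Prime] {n : ℕ} {g : LaurentPoly ℤ_[p] n}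

theorem PadicInt.dvd_sub_pow_self (a : ℤ_[p]) : (p : ℤ_[p]) ∣ a - a ^ p := by
  rw [← Ideal.mem_span_singleton, ← PadicInt.maximalIdeal_eq_span_p, ← PadicInt.ker_toZMod,
    RingHom.mem_ker, map_sub, map_pow, ZMod.pow_card, sub_self]

open Classical in
/-- The part of the series `q` given by the exponents that satisfy `S`. -/
def restrictedSeries (g : LaurentPoly ℤ_[p] n) (S : ℕ → Prop) : ℤ_[p]⟦X⟧ :=
  PowerSeries.mk fun N => if S N then b g N else 0

/-- `h(t) ↦ h(t^p)` as a ring homomorphism. -/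
def expandHom (p : ℕ) [Fact p.Prime] : ℤ_[p]⟦X⟧ →+* ℤ_[p]⟦X⟧ :=
  ((PowerSeries.expand p (Fact.out : p.Prime).ne_zero : ℤ_[p]⟦X⟧ →ₐ[ℤ_[p]] ℤ_[p]⟦X⟧) :
    ℤ_[p]⟦X⟧ →+* ℤ_[p]⟦X⟧)

/-- The generating polynomial of the ghost terms of level `l`. -/
def ghostSeries (g : LaurentPoly ℤ_[p] n) (l : ℕ) : ℤ_[p]⟦X⟧ :=
  PowerSeries.mk fun r => if r < p ^ (l + 1) then ghostTerm p g l r else 0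

theorem dvd_ghostSeries (g : LaurentPoly ℤ_[p] n) (l : ℕ) :
    (p : ℤ_[p]⟦X⟧) ^ l ∣ ghostSeries g l := by
  refine natCast_pow_dvd_of_coeff fun N => ?_
  rw [ghostSeries, coeff_mk]
  split_ifs
  · exact dvd_ghostTerm hp.out PadicInt.dvd_sub_pow_self g l N
  · exact dvd_zero _

/-- Treats `q` and its truncations at once: by `hS`, a condition on `N` depends only on the leading
digits that survive in `N / p^l`, so it passes through the recursion. -/
theorem dvd_restrictedSeries_sub_sum (hg : ZeroIsOnlyInteriorLatticePoint g)
    {S : ℕ → ℕ → Prop} (hS : ∀ k l N, S (k + l) N ↔ S k (N / p ^ l)) (s : ℕ) :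
    (p : ℤ_[p]⟦X⟧) ^ s ∣ restrictedSeries g (S s) - ∑ l ∈ range s,
      ghostSeries g l * (expandHom p ^ (l + 1)) (restrictedSeries g (S (s - 1 - l))) := by
  refine natCast_pow_dvd_of_coeff fun N => ?_
  have e : coeff N (restrictedSeries g (S s) - ∑ l ∈ range s,
      ghostSeries g l * (expandHom p ^ (l + 1)) (restrictedSeries g (S (s - 1 - l)))) =
      open Classical in if S s N then ghostTerm p g s N else 0 := by
    rw [map_sub, map_sum]
    have : ∀ l ∈ range s, coeff N (ghostSeries g l *
        (expandHom p ^ (l + 1)) (restrictedSeries g (S (s - 1 - l)))) =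
        open Classical in if S s N then
          ghostTerm p g l (N % p ^ (l + 1)) * b g (N / p ^ (l + 1)) else 0 := by
      intro l hl
      have hl := Finset.mem_range.1 hl
      rw [expandHom, expand_pow_apply, ghostSeries, coeff_mk_mul_expand, restrictedSeries,
        coeff_mk]
      have h := hS (s - 1 - l) (l + 1) N
      rw [show s - 1 - l + (l + 1) = s by omega] at h
      rw [mul_ite, mul_zero]
      classical exact if_congr h.symm rfl rfl
    rw [Finset.sum_congr rfl this, restrictedSeries, coeff_mk]
    split_ifs
    · rw [b_eq_sum_ghostTerm hg hp.out.pos s N]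
      ring
    · simp
  rw [e]
  split_ifs
  · exact dvd_ghostTerm hp.out PadicInt.dvd_sub_pow_self g s N
  · exact dvd_zero _

theorem restrictedSeries_true (g : LaurentPoly ℤ_[p] n) :
    restrictedSeries g (fun _ => True) = q g := by
  ext N; simp [restrictedSeries, q]

theorem restrictedSeries_lt (g : LaurentPoly ℤ_[p] n) (m : ℕ) :
    restrictedSeries g (fun N => N < m) = γ g m := by
  ext N
  simp [restrictedSeries, γ, q, coeff_trunc]

theorem isUnit_q (g : LaurentPoly ℤ_[p] n) : IsUnit (q g) := by
  rw [isUnit_iff_constantCoeff, ← coeff_zero_eq_constantCoeff_apply]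
  simp [q, b, AddMonoidAlgebra.one_def]

theorem isUnit_γ (g : LaurentPoly ℤ_[p] n) {m : ℕ} (hm : 0 < m) : IsUnit (γ g m) := by
  rw [isUnit_iff_constantCoeff, ← coeff_zero_eq_constantCoeff_apply]
  simp [γ, q, b, AddMonoidAlgebra.one_def, coeff_trunc, hm]

theorem atPow_eq_expandHom (f : ℤ_[p]⟦X⟧) : atPow p f = expandHom p f := rfl

theorem dvd_γ_quotient (hg : ZeroIsOnlyInteriorLatticePoint g) {m : ℕ} {u : ℕ → ℤ_[p]⟦X⟧}
    (hu : ∀ k, γ g (m * p ^ k) = u k * q g) (s : ℕ) :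
    (p : ℤ_[p]⟦X⟧) ^ (s + 1) ∣ u (s + 1) - expandHom p (u s) := by
  refine dvd_quotient_sub_map (σ := expandHom p) (D := ghostSeries g)
    (F := fun k => γ g (m * p ^ k)) (G := fun _ => q g)
    (dvd_ghostSeries g) hu (fun _ => isUnit_q g) ?_ ?_ s
  · intro s
    simp only [← restrictedSeries_lt]
    refine dvd_restrictedSeries_sub_sum hg (S := fun k N => N < m * p ^ k) (fun k l N => ?_) s
    rw [Nat.div_lt_iff_lt_mul (pow_pos hp.out.pos l), pow_add, mul_assoc]
  · intro s
    simp only [← restrictedSeries_true]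
    exact dvd_restrictedSeries_sub_sum hg (S := fun _ _ => True) (fun _ _ _ => Iff.rfl) s

theorem exists_γ_quotient (g : LaurentPoly ℤ_[p] n) (m : ℕ) :
    ∃ u : ℕ → ℤ_[p]⟦X⟧, ∀ k, γ g (m * p ^ k) = u k * q g := by
  refine ⟨fun k => γ g (m * p ^ k) * Ring.inverse (q g), fun k => ?_⟩
  rw [mul_assoc, Ring.inverse_mul_cancel _ (isUnit_q g), mul_one]

theorem quotCongr_atPow (hg : ZeroIsOnlyInteriorLatticePoint g) {m : ℕ} (hm : 0 < m) (s : ℕ) :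
    QuotCongr p (s + 1) (q g) (atPow p (q g)) (γ g (m * p ^ (s + 1)))
      (atPow p (γ g (m * p ^ s))) := by
  have h₁ : IsUnit (atPow p (q g)) := (isUnit_q g).map (expandHom p)
  have h₂ : IsUnit (atPow p (γ g (m * p ^ s))) :=
    (isUnit_γ g (Nat.mul_pos hm (pow_pos hp.out.pos s))).map (expandHom p)
  refine ⟨h₁, h₂, dvd_mul_inverse_sub_mul_inverse h₁ h₂ ?_⟩
  obtain ⟨u, hu⟩ := exists_γ_quotient g m
  -- With `σ = expandHom p`, the cross difference is `-(u (s + 1) - σ (u s)) q σ(q)`.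
  have h := (dvd_γ_quotient hg hu s).mul_right (-(q g * expandHom p (q g)))
  rw [atPow_eq_expandHom, atPow_eq_expandHom, hu, hu, map_mul]
  convert h using 1
  ring

theorem dvd_derivative_γ_quotient (hg : ZeroIsOnlyInteriorLatticePoint g) {m : ℕ}
    {u : ℕ → ℤ_[p]⟦X⟧} (hu : ∀ k, γ g (m * p ^ k) = u k * q g) (s : ℕ) :
    (p : ℤ_[p]⟦X⟧) ^ s ∣ PowerSeries.derivative ℤ_[p] (u s) := by
  induction s with
  | zero => simp
  | succ s ih =>
    have h₁ := dvd_derivative (dvd_γ_quotient hg hu s)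
    have h₂ : (p : ℤ_[p]⟦X⟧) ^ (s + 1) ∣
        PowerSeries.derivative ℤ_[p] (expandHom p (u s)) := by
      have h := map_dvd (expandHom p) ih
      rw [map_pow, map_natCast] at h
      change _ ∣ PowerSeries.derivative ℤ_[p] (PowerSeries.expand p hp.out.ne_zero (u s))
      rw [derivative_expand, pow_succ', mul_assoc]
      exact mul_dvd_mul_left _ (h.mul_left _)
    simpa using dvd_add h₁ h₂

theorem quotCongr_derivative (hg : ZeroIsOnlyInteriorLatticePoint g) {m : ℕ} (hm : 0 < m)
    (s : ℕ) : QuotCongr p s (PowerSeries.derivative ℤ_[p] (q g)) (q g)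
      (PowerSeries.derivative ℤ_[p] (γ g (m * p ^ s))) (γ g (m * p ^ s)) := by
  have h₂ := isUnit_γ g (Nat.mul_pos hm (pow_pos hp.out.pos s))
  refine ⟨isUnit_q g, h₂, dvd_mul_inverse_sub_mul_inverse (isUnit_q g) h₂ ?_⟩
  obtain ⟨u, hu⟩ := exists_γ_quotient g m
  -- By the Leibniz rule for `γ = u q`, `q' γ - γ' q = -u' q²`.
  have h := (dvd_derivative_γ_quotient hg hu s).mul_right (-(q g * q g))
  rw [hu, Derivation.leibniz]
  convert h using 1
  simp only [smul_eq_mul]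
  ring

end Congruences

end

end DworkCongruence

theorem mainTheorem3 (p : ℕ) [Fact p.Prime] (n : ℕ)
    (g : DworkCongruence.LaurentPoly ℤ_[p] n)
    (hg : DworkCongruence.ZeroIsOnlyInteriorLatticePoint g) :
    (∀ s : ℕ, 1 ≤ s →
      DworkCongruence.QuotCongr p s
        (DworkCongruence.q g)
        (DworkCongruence.atPow p (DworkCongruence.q g))
        (DworkCongruence.γ g (p ^ s))
        (DworkCongruence.atPow p (DworkCongruence.γ g (p ^ (s - 1))))) ∧
    (∀ m : ℕ, 1 ≤ m → p ∣ m →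
      DworkCongruence.QuotCongr p (padicValNat p m)
        (DworkCongruence.q g)
        (DworkCongruence.atPow p (DworkCongruence.q g))
        (DworkCongruence.γ g m)
        (DworkCongruence.atPow p (DworkCongruence.γ g (m / p)))) ∧
    (∀ m : ℕ, 1 ≤ m →
      DworkCongruence.QuotCongr p (padicValNat p m)
        (PowerSeries.derivative ℤ_[p] (DworkCongruence.q g))
        (DworkCongruence.q g)
        (PowerSeries.derivative ℤ_[p] (DworkCongruence.γ g m))
        (DworkCongruence.γ g m)) := by
  have hp : p.Prime := Fact.out
  have main : ∀ m : ℕ, 1 ≤ m → p ∣ m →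
      DworkCongruence.QuotCongr p (padicValNat p m)
        (DworkCongruence.q g)
        (DworkCongruence.atPow p (DworkCongruence.q g))
        (DworkCongruence.γ g m)
        (DworkCongruence.atPow p (DworkCongruence.γ g (m / p))) := by
    intro m hm hpm
    obtain ⟨c, hc⟩ := pow_padicValNat_dvd (p := p) (n := m)
    -- As `p ∣ m`, the valuation is some `s + 1`, so that `m / p = c * p ^ s`.
    obtain ⟨s, hs⟩ := Nat.exists_eq_succ_of_ne_zero
      (dvd_iff_padicValNat_ne_zero (p := p) (by omega : m ≠ 0) |>.1 hpm)
    rw [hs] at hc ⊢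
    have hc0 : 0 < c := Nat.pos_of_ne_zero (by rintro rfl; omega)
    have hm1 : m = c * p ^ (s + 1) := by rw [hc, mul_comm]
    have hm2 : m / p = c * p ^ s := by
      rw [hm1, pow_succ, ← mul_assoc, Nat.mul_div_cancel _ hp.pos]
    rw [hm2, hm1]
    exact DworkCongruence.quotCongr_atPow hg hc0 s
  refine ⟨fun s hs => ?_, main, fun m hm => ?_⟩
  · obtain ⟨s, rfl⟩ := Nat.exists_eq_add_of_le' hs
    have h := main (p ^ (s + 1)) (Nat.one_le_pow _ _ hp.pos) (dvd_pow_self p (by omega))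
    rwa [padicValNat.prime_pow, pow_succ, Nat.mul_div_cancel _ hp.pos, ← pow_succ] at h
  · obtain ⟨c, hc⟩ := pow_padicValNat_dvd (p := p) (n := m)
    have hc0 : 0 < c := Nat.pos_of_ne_zero (by rintro rfl; omega)
    have h := DworkCongruence.quotCongr_derivative hg hc0 (padicValNat p m)
    rwa [mul_comm c, ← hc] at h
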